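/- Let $d$ be a nonnegative integer and let $B$ be any $d\times d$ complex matrix. Let $I$ be the $d\times d$ identity matrix, and let $$Z_1=\begin{pmatrix} I & B\\ B^* & BB^*\end{pmatrix},\qquad Z_2=\begin{pmatrix} I & B^*\\ B & B^*B\end{pmatrix},$$ which are Hermitian $2d\times 2d$ matrices. Write $|X|=(X^*X)^{1/2}$, and let $\|X\|_1=\operatorname{tr}|X|$ denote the trace norm and $\|X\|_2=(\operatorname{tr}X^*X)^{1/2}$ the Frobenius norm. Then, for $i=1,2$, $$\|Z_i\|_1-\operatorname{tr}Z_i\le 2\sqrt{d/2}\,\|B\|_2,$$ and $$\left(\|Z_1\|_1-\operatorname{tr}Z_1\right)^2+\left(\|Z_2\|_1-\operatorname{tr}Z_2\right)^2\le\left(2\,\|I\|_2\,\|B\|_2\right)^2=4d\,\|B\|_2^2 .$$ -/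

import Mathlib

open scoped Matrix

noncomputable section

/-- The trace norm (Schatten `1`-norm) `‖X‖₁ = tr |X|` of a complex square matrix, where
`|X| = (Xᴴ X)^(1/2)` is the matrix modulus, obtained by applying the square root to the positive
semidefinite matrix `Xᴴ X` in the functional calculus. This trace is a nonnegative real number;
`.re` reads it as an element of `ℝ`. -/
def traceNorm {ι : Type*} [Fintype ι] [DecidableEq ι] (X : Matrix ι ι ℂ) : ℝ :=
  (Matrix.trace (cfc Real.sqrt (Xᴴ * X))).re

/-- The negativity `N(X) = ‖X‖₁ - tr X` of a Hermitian matrix `X`. The trace of a Hermitian matrix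
is real; `.re` reads it as an element of `ℝ`. -/
def negativity {ι : Type*} [Fintype ι] [DecidableEq ι] (X : Matrix ι ι ℂ) : ℝ :=
  traceNorm X - (Matrix.trace X).re

/-- The Frobenius norm (Schatten `2`-norm) `‖X‖₂` of a complex matrix. -/
def frobeniusNorm {m n : Type*} [Fintype m] [Fintype n] (X : Matrix m n ℂ) : ℝ :=
  letI : NormedAddCommGroup (Matrix m n ℂ) := Matrix.frobeniusNormedAddCommGroup
  ‖X‖

end

section

variable {n : Type*} [Fintype n]

/-! The negativity of `Z` is `-2 tr (Z P)`, where `P = (X, W; Wᴴ, Y)` is the spectral projection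
onto the negative eigenspaces (`exists_projection_negativity_eq`). Put `K = 2W`, a contraction, and
compress `P ≥ 0` by the row `(Kᴴ Kᴴ, Bᴴ)`. The term `tr (B Bᴴ Y)`, quadratic in `B`, appears here
exactly as in `tr (Z P)` and cancels; as `Kᴴ Kᴴ` is a contraction, the `X` terms have a favourable
sign. What remains is linear in `B`: the negativity is at most `2 Re tr (B Kᴴ (Kᴴ K - 1))`.
Cauchy-Schwarz and `frobeniusNorm_mul_sub_one_le` finish. The sum-of-squares bound follows from the
two individual bounds. -/

lemma frobeniusNorm_eq_sqrt_sum {m : Type*} [Fintype m] (X : Matrix m n ℂ) :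
    frobeniusNorm X = √(∑ p : m × n, ‖X p.1 p.2‖ ^ 2) := by
  rw [Fintype.sum_prod_type, Real.sqrt_eq_rpow]
  simpa [frobeniusNorm] using Matrix.frobenius_norm_def X

lemma frobeniusNorm_nonneg (X : Matrix n n ℂ) : 0 ≤ frobeniusNorm X := by
  rw [frobeniusNorm_eq_sqrt_sum]
  positivity

lemma frobeniusNorm_conjTranspose (X : Matrix n n ℂ) : frobeniusNorm Xᴴ = frobeniusNorm X :=
  Matrix.frobenius_norm_conjTranspose X

lemma frobeniusNorm_one_sq [DecidableEq n] :
    frobeniusNorm (1 : Matrix n n ℂ) ^ 2 = Fintype.card n := by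
  rw [frobeniusNorm_eq_sqrt_sum, Real.sq_sqrt (by positivity), Fintype.sum_prod_type]
  simp [Matrix.one_apply, apply_ite]

lemma frobeniusNorm_eq_sqrt_trace (X : Matrix n n ℂ) :
    frobeniusNorm X = √(Matrix.trace (Xᴴ * X)).re := by
  rw [frobeniusNorm_eq_sqrt_sum, Fintype.sum_prod_type_right]
  congr 1
  simp [Matrix.trace, Matrix.mul_apply, Complex.sq_norm, Complex.normSq_apply]

/-- The Cauchy-Schwarz inequality for the Hilbert-Schmidt pairing. -/
lemma re_trace_mul_le (X Y : Matrix n n ℂ) :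
    (Matrix.trace (X * Y)).re ≤ frobeniusNorm X * frobeniusNorm Y := by
  rw [← frobeniusNorm_conjTranspose Y, frobeniusNorm_eq_sqrt_sum, frobeniusNorm_eq_sqrt_sum]
  refine le_trans ?_ (Real.sum_mul_le_sqrt_mul_sqrt _ _ _)
  rw [Fintype.sum_prod_type]
  simp only [Matrix.trace, Matrix.diag_apply, Matrix.mul_apply, Complex.re_sum]
  refine Finset.sum_le_sum fun i _ ↦ Finset.sum_le_sum fun j _ ↦ ?_
  simpa using Complex.re_le_norm (X i j * Y j i)

lemma trace_fromBlocks_eq_add (X W V Y : Matrix n n ℂ) :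
    Matrix.trace (Matrix.fromBlocks X W V Y) = Matrix.trace X + Matrix.trace Y := by
  simp [Matrix.trace]

open scoped ComplexOrder in
lemma Matrix.PosSemidef.re_trace_nonneg {X : Matrix n n ℂ} (hX : X.PosSemidef) :
    0 ≤ X.trace.re :=
  (Complex.le_def.1 hX.trace_nonneg).1

lemma re_trace_conjTranspose (X : Matrix n n ℂ) : (Matrix.trace Xᴴ).re = (Matrix.trace X).re := by
  simp [Matrix.trace_conjTranspose]

end

section

variable {n : Type*} [Fintype n] [DecidableEq n]

open scoped ComplexOrder in
/-- For a contraction `K`, the Frobenius norm of `Kᴴ (Kᴴ K - 1)` is at most `√(n / 2)`. -/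
lemma frobeniusNorm_mul_sub_one_le {K : Matrix n n ℂ} (h₁ : (1 - K * Kᴴ).PosSemidef)
    (h₂ : (1 - Kᴴ * K).PosSemidef) :
    frobeniusNorm (Kᴴ * (Kᴴ * K - 1)) ≤ √((Fintype.card n : ℝ) / 2) := by
  rw [frobeniusNorm_eq_sqrt_trace]
  apply Real.sqrt_le_sqrt
  set A := K * Kᴴ with hA
  set M := Kᴴ * K with hM
  have hAh : Aᴴ = A := by simp [hA]
  have hMh : Mᴴ = M := by simp [hM]
  have e₁ : Matrix.trace ((Kᴴ * (M - 1))ᴴ * (Kᴴ * (M - 1))) =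
      Matrix.trace ((M - 1) * A * (M - 1)) := by
    simp [hMh, hA, Matrix.mul_assoc]
  have e₂ : Matrix.trace ((M - 1) * A * (M - 1)) =
      Matrix.trace (A * (M * M)) - 2 * Matrix.trace (A * M) + Matrix.trace A := by
    rw [Matrix.mul_assoc, Matrix.trace_mul_comm, Matrix.mul_assoc,
      show A * ((M - 1) * (M - 1)) = A * (M * M) - A * M - A * M + A by noncomm_ring]
    simp only [Matrix.trace_add, Matrix.trace_sub]
    ring
  have hMM : M - M * M = Kᴴ * (1 - A) * Kᴴᴴ := by
    simp only [hA, hM, Matrix.conjTranspose_conjTranspose]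
    noncomm_ring
  have hAA : A - A * A = K * (1 - M) * Kᴴ := by
    simp only [hA, hM]
    noncomm_ring
  -- This bounds the squared norm by `tr A - tr (A M)`.
  have p₁ : 0 ≤ (Matrix.trace (A * (M - M * M))).re := by
    rw [hA, Matrix.mul_assoc, Matrix.trace_mul_comm, hMM]
    simpa using ((h₁.mul_mul_conjTranspose_same Kᴴ).mul_mul_conjTranspose_same Kᴴ).re_trace_nonneg
  -- Source of the constant `n / 2`: expanding the square of `A + M - 1`, then using `tr A² ≤ tr A`,
  -- `tr M² ≤ tr M` and `tr A = tr M`, gives `tr A - tr (A M) ≤ n / 2`.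
  have p₂ : 0 ≤ (Matrix.trace ((A - (1 - M)) * (A - (1 - M)))).re := by
    have := (Matrix.posSemidef_conjTranspose_mul_self (A - (1 - M))).re_trace_nonneg
    simpa [hAh, hMh] using this
  have p₃ : 0 ≤ (Matrix.trace (M - M * M)).re := by
    rw [hMM]
    exact (h₁.mul_mul_conjTranspose_same Kᴴ).re_trace_nonneg
  have p₄ : 0 ≤ (Matrix.trace (A - A * A)).re := by
    rw [hAA]
    exact (h₂.mul_mul_conjTranspose_same K).re_trace_nonneg
  have e₃ : Matrix.trace ((A - (1 - M)) * (A - (1 - M))) =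
      Matrix.trace (A * A) + Matrix.trace (M * M) + 2 * Matrix.trace (A * M)
        - 2 * Matrix.trace A - 2 * Matrix.trace M + Fintype.card n := by
    rw [show (A - (1 - M)) * (A - (1 - M)) =
      A * A + M * M + A * M + M * A - A - A - M - M + 1 by noncomm_ring]
    simp only [Matrix.trace_add, Matrix.trace_sub, Matrix.trace_mul_comm M A, Matrix.trace_one]
    ring
  have e₄ : Matrix.trace A = Matrix.trace M := Matrix.trace_mul_comm _ _
  rw [e₁, e₂]
  rw [e₃] at p₂
  simp only [Matrix.mul_sub, Matrix.trace_sub, Complex.sub_re, Complex.add_re, Complex.mul_re,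
    Complex.re_ofNat, Complex.im_ofNat, Complex.natCast_re, zero_mul, sub_zero, e₄]
    at p₁ p₂ p₃ p₄ ⊢
  linarith

open scoped ComplexOrder in
/-- The negativity of a Hermitian matrix is nonnegative, and is computed by the spectral projection
onto the negative eigenspaces. -/
lemma exists_projection_negativity_eq {Z : Matrix n n ℂ} (hZ : Z.IsHermitian) :
    0 ≤ negativity Z ∧ ∃ P : Matrix n n ℂ, Pᴴ = P ∧ P * P = P ∧
      negativity Z = -2 * (Matrix.trace (Z * P)).re := by
  -- The spectrum is finite, so even the discontinuous indicator of the negative axis is admissible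
  -- in the functional calculus.
  have hc (f : ℝ → ℝ) : ContinuousOn f (spectrum ℝ Z) := Z.finite_real_spectrum.continuousOn f
  have hs : IsSelfAdjoint Z := hZ
  have habs : cfc Real.sqrt (Zᴴ * Z) = cfc (fun x : ℝ ↦ |x|) Z := by
    rw [hZ.eq]
    nth_rw 1 2 [← cfc_id' ℝ Z]
    rw [← cfc_mul _ _ _ (hc _) (hc _),
      ← cfc_comp' Real.sqrt _ Z Real.continuous_sqrt.continuousOn (hc _)]
    simp [Real.sqrt_mul_self_eq_abs]
  have hneg : negativity Z = (Matrix.trace (cfc (fun x : ℝ ↦ |x| - x) Z)).re := by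
    rw [negativity, traceNorm, habs, cfc_sub _ _ _ (hc _) (hc _), cfc_id' ℝ Z, Matrix.trace_sub,
      Complex.sub_re]
  refine ⟨?_, cfc (fun x : ℝ ↦ if x < 0 then 1 else 0) Z,
    (cfc_predicate (R := ℝ) _ Z : IsSelfAdjoint _), ?_, ?_⟩
  · have hq : (cfc (fun x : ℝ ↦ √(|x| - x)) Z)ᴴ = cfc (fun x : ℝ ↦ √(|x| - x)) Z :=
      (cfc_predicate (R := ℝ) _ Z : IsSelfAdjoint _)
    have : cfc (fun x : ℝ ↦ |x| - x) Z =
        (cfc (fun x : ℝ ↦ √(|x| - x)) Z)ᴴ * cfc (fun x : ℝ ↦ √(|x| - x)) Z := by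
      rw [hq, ← cfc_mul _ _ _ (hc _) (hc _)]
      congr 1
      ext x
      rw [Real.mul_self_sqrt (sub_nonneg.2 (le_abs_self x))]
    rw [hneg, this]
    exact (Matrix.posSemidef_conjTranspose_mul_self _).re_trace_nonneg
  · rw [← cfc_mul _ _ _ (hc _) (hc _)]
    congr 1
    ext x
    split_ifs <;> simp
  · have : cfc (fun x : ℝ ↦ |x| - x) Z =
        (-2 : ℝ) • (Z * cfc (fun x : ℝ ↦ if x < 0 then 1 else 0) Z) := by
      nth_rw 2 [← cfc_id' ℝ Z]
      rw [← cfc_mul _ _ _ (hc _) (hc _), ← cfc_const_mul _ _ _ (hc _)]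
      congr 1
      ext x
      split_ifs with h
      · rw [abs_of_neg h]
        ring
      · rw [abs_of_nonneg (not_lt.1 h)]
        ring
    rw [hneg, this, Matrix.trace_smul, Complex.real_smul, Complex.re_ofReal_mul]

open scoped ComplexOrder in
/-- The negativity of `(1, B; Bᴴ, B Bᴴ)` is at most `2 √(n / 2) ‖B‖₂`. -/
lemma negativity_fromBlocks_le (B : Matrix n n ℂ) :
    negativity (Matrix.fromBlocks 1 B Bᴴ (B * Bᴴ)) ≤
      2 * √((Fintype.card n : ℝ) / 2) * frobeniusNorm B := by
  obtain ⟨-, P, hPh, hPP, hP⟩ := exists_projection_negativity_eq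
    (Z := Matrix.fromBlocks 1 B Bᴴ (B * Bᴴ))
    (Matrix.IsHermitian.fromBlocks (by simp) rfl (by simp [Matrix.IsHermitian]))
  have hpos : P.PosSemidef := by
    rw [← hPP]
    nth_rw 1 [← hPh]
    exact Matrix.posSemidef_conjTranspose_mul_self P
  obtain ⟨X, W, V, Y, rfl⟩ : ∃ X W V Y, P = Matrix.fromBlocks X W V Y :=
    ⟨_, _, _, _, P.fromBlocks_toBlocks.symm⟩
  rw [Matrix.fromBlocks_conjTranspose, Matrix.fromBlocks_inj] at hPh
  obtain ⟨hX, -, rfl, hY⟩ := hPh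
  rw [Matrix.fromBlocks_multiply, Matrix.fromBlocks_inj] at hPP
  obtain ⟨hXX, -, -, hYY⟩ := hPP
  -- `K` is the off-diagonal block of the Hermitian involution `2P - 1`, whence `K Kᴴ = 1 - (1 -
  -- 2X)²` and `Kᴴ K = 1 - (1 - 2Y)²`.
  obtain ⟨K, hK⟩ : ∃ K : Matrix n n ℂ, K = W + W := ⟨_, rfl⟩
  have h₁ : (1 - K * Kᴴ).PosSemidef := by
    convert Matrix.posSemidef_self_mul_conjTranspose (1 - X - X) using 1
    rw [← eq_sub_iff_add_eq'] at hXX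
    simp only [hK, Matrix.conjTranspose_add, Matrix.conjTranspose_sub, hX,
      Matrix.conjTranspose_one, Matrix.add_mul, Matrix.mul_add, hXX]
    noncomm_ring
  have h₂ : (1 - Kᴴ * K).PosSemidef := by
    convert Matrix.posSemidef_self_mul_conjTranspose (1 - Y - Y) using 1
    rw [← eq_sub_iff_add_eq] at hYY
    simp only [hK, Matrix.conjTranspose_add, Matrix.conjTranspose_sub, hY,
      Matrix.conjTranspose_one, Matrix.add_mul, Matrix.mul_add, hYY]
    noncomm_ring
  -- `Kᴴ * Kᴴ` is a contraction, so conjugating `X` by it does not increase the trace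
  have hQ : (1 - K * K * (Kᴴ * Kᴴ)).PosSemidef := by
    convert h₁.add (h₁.mul_mul_conjTranspose_same K) using 1
    noncomm_ring
  have hL : (Matrix.trace (Kᴴ * Kᴴ * X * (K * K))).re ≤ (Matrix.trace X).re := by
    -- With `Q = 1 - K K Kᴴ Kᴴ`, the identity `X = X X + W Wᴴ` splits `tr (X Q)` into traces of two
    -- positive semidefinite matrices.
    have hx := (hQ.mul_mul_conjTranspose_same X).re_trace_nonneg
    have hw := (hQ.mul_mul_conjTranspose_same Wᴴ).re_trace_nonneg
    rw [Matrix.trace_mul_comm, ← Matrix.mul_assoc] at hx hw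
    rw [hX] at hx
    rw [Matrix.conjTranspose_conjTranspose] at hw
    have := add_nonneg hx hw
    rw [← Complex.add_re, ← Matrix.trace_add, ← Matrix.add_mul, hXX, Matrix.mul_sub,
      Matrix.mul_one, Matrix.trace_sub, Complex.sub_re, ← Matrix.mul_assoc,
      Matrix.trace_mul_comm, ← Matrix.mul_assoc] at this
    linarith
  have hR := (hpos.mul_mul_conjTranspose_same (Matrix.fromCols (Kᴴ * Kᴴ) Bᴴ)).re_trace_nonneg
  have hR' : Matrix.trace (Matrix.fromCols (Kᴴ * Kᴴ) Bᴴ * Matrix.fromBlocks X W Wᴴ Y *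
      (Matrix.fromCols (Kᴴ * Kᴴ) Bᴴ)ᴴ) = Matrix.trace (Kᴴ * Kᴴ * X * (K * K)) +
      Matrix.trace (B * (Kᴴ * Kᴴ * W)) + Matrix.trace (B * (Kᴴ * Kᴴ * W))ᴴ +
      Matrix.trace (B * Bᴴ * Y) := by
    rw [Matrix.trace_mul_comm B, Matrix.conjTranspose_mul, Matrix.trace_mul_comm _ Bᴴ,
      Matrix.mul_assoc B, Matrix.trace_mul_comm B]
    simp only [Matrix.fromCols_mul_fromBlocks, Matrix.fromCols_mul_fromRows, Matrix.trace_add,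
      Matrix.conjTranspose_fromCols_eq_fromRows_conjTranspose, Matrix.conjTranspose_conjTranspose,
      Matrix.conjTranspose_mul, Matrix.add_mul, Matrix.mul_assoc]
    ring
  have hZP : Matrix.trace (Matrix.fromBlocks 1 B Bᴴ (B * Bᴴ) * Matrix.fromBlocks X W Wᴴ Y) =
      Matrix.trace X + Matrix.trace (B * Wᴴ) + Matrix.trace (B * Wᴴ)ᴴ +
      Matrix.trace (B * Bᴴ * Y) := by
    simp only [Matrix.fromBlocks_multiply, trace_fromBlocks_eq_add, Matrix.trace_add,
      Matrix.one_mul, Matrix.conjTranspose_mul, Matrix.conjTranspose_conjTranspose,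
      Matrix.trace_mul_comm W]
    ring
  have hG : Matrix.trace (B * (Kᴴ * (Kᴴ * K - 1))) =
      2 * Matrix.trace (B * (Kᴴ * Kᴴ * W)) - 2 * Matrix.trace (B * Wᴴ) := by
    have hLK : Kᴴ * Kᴴ * K = Kᴴ * Kᴴ * W + Kᴴ * Kᴴ * W := by rw [← Matrix.mul_add, ← hK]
    have hKh : Kᴴ = Wᴴ + Wᴴ := by rw [hK, Matrix.conjTranspose_add]
    rw [Matrix.mul_sub, Matrix.mul_one, ← Matrix.mul_assoc, hLK, Matrix.mul_sub, Matrix.mul_add,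
      Matrix.trace_sub, Matrix.trace_add]
    nth_rw 5 [hKh]
    rw [Matrix.mul_add, Matrix.trace_add]
    ring
  have hCS := (re_trace_mul_le B (Kᴴ * (Kᴴ * K - 1))).trans
    (mul_le_mul_of_nonneg_left (frobeniusNorm_mul_sub_one_le h₁ h₂) (frobeniusNorm_nonneg B))
  rw [hP, hZP]
  rw [hR'] at hR
  rw [hG] at hCS
  simp only [Complex.add_re, Complex.sub_re, Complex.mul_re, Complex.re_ofNat, Complex.im_ofNat,
    zero_mul, sub_zero, re_trace_conjTranspose] at hR hCS ⊢
  linarith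

end

theorem mainTheorem1 (d : ℕ) (B : Matrix (Fin d) (Fin d) ℂ) :
    negativity (Matrix.fromBlocks 1 B Bᴴ (B * Bᴴ)) ≤ 2 * √((d : ℝ) / 2) * frobeniusNorm B ∧
    negativity (Matrix.fromBlocks 1 Bᴴ B (Bᴴ * B)) ≤ 2 * √((d : ℝ) / 2) * frobeniusNorm B ∧
    negativity (Matrix.fromBlocks 1 B Bᴴ (B * Bᴴ)) ^ 2 +
        negativity (Matrix.fromBlocks 1 Bᴴ B (Bᴴ * B)) ^ 2 ≤
      (2 * frobeniusNorm (1 : Matrix (Fin d) (Fin d) ℂ) * frobeniusNorm B) ^ 2 ∧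
    (2 * frobeniusNorm (1 : Matrix (Fin d) (Fin d) ℂ) * frobeniusNorm B) ^ 2 =
      4 * (d : ℝ) * frobeniusNorm B ^ 2 := by
  have hle₁ := negativity_fromBlocks_le B
  have hle₂ := negativity_fromBlocks_le Bᴴ
  rw [frobeniusNorm_conjTranspose, Matrix.conjTranspose_conjTranspose] at hle₂
  rw [Fintype.card_fin] at hle₁ hle₂
  have hnn₁ := (exists_projection_negativity_eq
    (Z := Matrix.fromBlocks 1 B Bᴴ (B * Bᴴ))
    (Matrix.IsHermitian.fromBlocks (by simp) rfl (by simp [Matrix.IsHermitian]))).1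
  have hnn₂ := (exists_projection_negativity_eq
    (Z := Matrix.fromBlocks 1 Bᴴ B (Bᴴ * B))
    (Matrix.IsHermitian.fromBlocks (by simp) (by simp) (by simp [Matrix.IsHermitian]))).1
  have heq : (2 * frobeniusNorm (1 : Matrix (Fin d) (Fin d) ℂ) * frobeniusNorm B) ^ 2 =
      4 * (d : ℝ) * frobeniusNorm B ^ 2 := by
    rw [mul_pow, mul_pow, frobeniusNorm_one_sq, Fintype.card_fin]
    ring
  have hsq : (2 * √((d : ℝ) / 2) * frobeniusNorm B) ^ 2 = 2 * d * frobeniusNorm B ^ 2 := by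
    rw [mul_pow, mul_pow, Real.sq_sqrt (by positivity)]
    ring
  refine ⟨hle₁, hle₂, ?_, heq⟩
  -- Each square is at most `2 d ‖B‖₂²`, half of the required total.
  have hsq₁ := pow_le_pow_left₀ hnn₁ hle₁ 2
  have hsq₂ := pow_le_pow_left₀ hnn₂ hle₂ 2
  rw [hsq] at hsq₁ hsq₂
  rw [heq]
  linarith
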